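/- For a finite undirected multigraph $G$ (parallel edges allowed) with $n$ vertices, a \emph{cut} of $G$ is the set of all edges of $G$ with exactly one end in $S$, for some nonempty proper subset $S$ of the vertices. For an edge failure probability $p\in(0,1)$ let $$z_G(p)=\sum_{C} p^{|C|},\qquad x_G(p)=\sum_{C\neq D} p^{|C\cup D|},$$ where $C$ ranges over the cuts of $G$ and $(C,D)$ over the ordered pairs of distinct cuts of $G$; these are the expected number of failed cuts and the expected number of failed cut pairs when every edge fails independently with probability $p$ (a cut fails if all its edges fail). Lemma. If $z_G(p)\le 1/n$, then $x_G(p)\le n^{-\Omega(1)}z_G(p)$. That is, there are absolute constants $c>0$ and $n_0$ such that for every finite undirected multigraph $G$ with $n\ge n_0$ vertices and every $p\in(0,1)$ with $z_G(p)\le 1/n$, $$x_G(p)\le n^{-c}\,z_G(p).$$ -/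

import Mathlib

namespace Unreliability

/-- The edge set of the cut of the multigraph `G` determined by the vertex set `S`: all edges of
`G` with one end in `S` and the other end outside `S`. -/
def boundary {α β : Type*} (G : Graph α β) (S : Set α) : Set β :=
  {e | ∃ x y, G.IsLink e x y ∧ x ∈ S ∧ y ∉ S}

/-- A cut of `G`, as a set of edges: the boundary of a nonempty proper subset of the vertices. -/
def IsCut {α β : Type*} (G : Graph α β) (C : Set β) : Prop :=
  ∃ S : Set α, S.Nonempty ∧ S ⊂ G.vertexSet ∧ C = boundary G S

/-- The expected number of failed cuts `z_G(p) = ∑_C p ^ |C|`, when every edge fails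
independently with probability `p`. -/
noncomputable def expFailedCuts {α β : Type*} (G : Graph α β) (p : ℝ) : ℝ :=
  ∑ᶠ C ∈ {C : Set β | IsCut G C}, p ^ C.ncard

/-- The expected number of failed cut pairs `x_G(p) = ∑_{C ≠ D} p ^ |C ∪ D|`, the sum being over
the ordered pairs of distinct cuts. -/
noncomputable def expFailedCutPairs {α β : Type*} (G : Graph α β) (p : ℝ) : ℝ :=
  ∑ᶠ P ∈ {P : Set β × Set β | IsCut G P.1 ∧ IsCut G P.2 ∧ P.1 ≠ P.2}, p ^ (P.1 ∪ P.2).ncard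

end Unreliability

/-!
Write `T = -log p`, `N = log n`, and measure edge sets in units of `N / T`, so that a set of size
`β` fails with probability `n ^ (-β)`. As `z ≤ 1 / n`, every cut has size at least `1` and at most
`n ^ (α - 1)` cuts have size less than `α`.

Let `F = C ∪ D` be the union of two distinct cuts, of size `β ≥ 1`. The heart of the argument is
that, after deletion of `F`, letting every other edge fail with probability `q = p ^ (9 / 10)`
leaves on average only `O(β)` components (`expNumComp_le`). Lower `q` gradually from `1`, that is,
put `q = p ^ θ` with `θ` growing from `0`. By the Margulis–Russo formula (`hasDerivAt_subsetExp`)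
the expected number `R` of components falls at a rate given by the expected number of edges outside
`F` between different components, which is half the sum of the component boundaries, up to `|F|`.
At most `O(β)` components can have a noticeable part of their boundary in `F`, since these parts add
up to at most `2 |F|`. Every other component of boundary less than `α` is a cut that survives almost
independently of `F`, and the expected number of such cuts is at most `n ^ (-1 + δ + α (1 - θ))` for
a small constant `δ` (`subsetExp_lightSides_le`). All remaining components have boundary at
least `α`. This is a linear differential inequality for `R`; it is used with `α = 2` for
`θ ≤ 1 / 2` and with `α = 3` afterwards.

Consequently `p ^ |F|` is at most twice the expected contribution of the pair `(C, D)` in the random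
contraction of the whole graph at failure probability `q`, restricted to contractions with `O(β)`
vertices, the edges of `F` still having to fail at `p' = p ^ (1 / 10)` (`sum_exp_sidePairs_le`).
In a contraction with `r` vertices there are at most `4 ^ r` pairs of cuts, and the identity
`|C| + |D| + |C ∆ D| = 2 |C ∪ D|` shows that `p' ^ |C ∪ D|` is at most `p' ^ (|C ∪ D| / 3)` times
the weight of a single surviving cut. The first factor is at most `n ^ (-β / 30)`, which beats `4 ^ r`
because `r = O(β)`, and a power of `n` is left over (`sum_sidePairs_le`). The expected weight of the
surviving cuts is `z` again.

Cuts are indexed throughout by vertex sets, so that in a connected graph each cut is counted twice.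
-/

namespace Unreliability

set_option linter.unusedSectionVars false

open Finset
open scoped Classical

noncomputable section


/-! ### Random subsets -/

/-- The expectation of `f A` for the random subset `A` of `U` that contains each element of `U`
independently with probability `1 - q`. -/
def subsetExp {E : Type*} (q : ℝ) (U : Finset E) (f : Finset E → ℝ) : ℝ :=
  ∑ A ∈ U.powerset, (1 - q) ^ #A * q ^ #(U \ A) * f A

section subsetExp

variable {E : Type*} {q : ℝ} {U : Finset E}

lemma subsetExp_insert {e : E} (he : e ∉ U) (q : ℝ) (f : Finset E → ℝ) :
    subsetExp q (insert e U) f =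
      q * subsetExp q U f + (1 - q) * subsetExp q U (fun A => f (insert e A)) := by
  unfold subsetExp
  rw [sum_powerset_insert he, mul_sum, mul_sum]
  congr 1
  · refine sum_congr rfl fun A hA => ?_
    have hA' : e ∉ A := fun h => he (mem_powerset.1 hA h)
    rw [insert_sdiff_of_notMem _ hA', card_insert_of_notMem (by simp [he])]
    ring
  · refine sum_congr rfl fun A hA => ?_
    have hA' : e ∉ A := fun h => he (mem_powerset.1 hA h)
    rw [insert_sdiff_insert, sdiff_insert_of_notMem he, card_insert_of_notMem hA']
    ring

lemma subsetExp_const (q : ℝ) (U : Finset E) (c : ℝ) : subsetExp q U (fun _ => c) = c := by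
  induction U using Finset.induction_on with
  | empty => simp [subsetExp]
  | insert e U he ih => rw [subsetExp_insert he, ih]; ring

lemma subsetExp_mono (h0 : 0 ≤ q) (h1 : q ≤ 1) {f g : Finset E → ℝ}
    (h : ∀ A ⊆ U, f A ≤ g A) : subsetExp q U f ≤ subsetExp q U g := by
  refine sum_le_sum fun A hA => mul_le_mul_of_nonneg_left (h A (mem_powerset.1 hA)) ?_
  have : 0 ≤ 1 - q := by linarith
  positivity

lemma subsetExp_add (f g : Finset E → ℝ) :
    subsetExp q U (fun A => f A + g A) = subsetExp q U f + subsetExp q U g := by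
  simp only [subsetExp, mul_add, sum_add_distrib]

lemma subsetExp_const_mul (c : ℝ) (f : Finset E → ℝ) :
    subsetExp q U (fun A => c * f A) = c * subsetExp q U f := by
  simp only [subsetExp, mul_sum]
  exact sum_congr rfl fun A _ => by ring

lemma subsetExp_sum {ι : Type*} (s : Finset ι) (f : ι → Finset E → ℝ) :
    subsetExp q U (fun A => ∑ i ∈ s, f i A) = ∑ i ∈ s, subsetExp q U (f i) := by
  simp only [subsetExp, mul_sum]
  exact sum_comm

/-- Conditioning on the event that the random subset avoids `B`. -/
lemma subsetExp_disjoint (q : ℝ) (U B : Finset E) (f : Finset E → ℝ) :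
    subsetExp q U (fun A => if Disjoint A B then f A else 0) =
      q ^ #(U ∩ B) * subsetExp q (U \ B) f := by
  have h : (U \ B).powerset = U.powerset.filter (fun A => Disjoint A B) := by
    ext A; simp [subset_sdiff]
  unfold subsetExp
  rw [h, sum_filter, mul_sum]
  refine sum_congr rfl fun A hA => ?_
  by_cases hd : Disjoint A B
  · have : #(U \ A) = #(U ∩ B) + #((U \ B) \ A) := by
      rw [← card_union_of_disjoint]
      · congr 1
        ext x
        have := fun hx : x ∈ A => disjoint_left.1 hd hx
        simp only [mem_sdiff, mem_union, mem_inter]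
        tauto
      · rw [disjoint_left]; intro x; simp only [mem_sdiff, mem_inter]; tauto
    simp only [hd, if_true, this, pow_add]; ring
  · simp only [hd, if_false, mul_zero]

/-- The Margulis–Russo formula: the derivative in `q` of the expectation of `f A`. -/
lemma hasDerivAt_subsetExp (U : Finset E) (q : ℝ) (hq : q ≠ 0) (f : Finset E → ℝ) :
    HasDerivAt (fun q => subsetExp q U f)
      (q⁻¹ * subsetExp q U (fun A => ∑ e ∈ U \ A, (f A - f (insert e A)))) q := by
  induction U using Finset.induction_on generalizing f with
  | empty => simpa [subsetExp] using hasDerivAt_const q (f ∅)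
  | insert e U he ih =>
    have hd := ((hasDerivAt_id q).mul (ih f)).add
      (((hasDerivAt_id q).const_sub 1).mul (ih fun A => f (insert e A)))
    have hfun : (fun q => subsetExp q (insert e U) f) =
        (id * fun q => subsetExp q U f) +
          ((fun x => 1 - id x) * fun q => subsetExp q U fun A => f (insert e A)) := by
      funext x; simp [subsetExp_insert he]
    rw [hfun]
    refine hd.congr_deriv (Eq.symm ?_)
    rw [subsetExp_insert he]
    have e1 : subsetExp q U (fun A => ∑ e' ∈ insert e U \ A, (f A - f (insert e' A))) =
        subsetExp q U (fun A => ∑ e' ∈ U \ A, (f A - f (insert e' A))) +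
          (subsetExp q U f + (-1) * subsetExp q U (fun A => f (insert e A))) := by
      rw [← subsetExp_const_mul, ← subsetExp_add, ← subsetExp_add]
      refine sum_congr rfl fun A hA => ?_
      have hA' : e ∉ A := fun h => he (mem_powerset.1 hA h)
      beta_reduce
      rw [insert_sdiff_of_notMem _ hA', sum_insert (by simp [he])]
      ring
    have e2 : subsetExp q U
          (fun A => ∑ e' ∈ insert e U \ insert e A, (f (insert e A) - f (insert e' (insert e A)))) =
        subsetExp q U
          (fun A => ∑ e' ∈ U \ A, (f (insert e A) - f (insert e (insert e' A)))) := by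
      refine sum_congr rfl fun A hA => ?_
      beta_reduce
      rw [insert_sdiff_insert, sdiff_insert_of_notMem he]
      congr 1
      exact sum_congr rfl fun e' _ => by rw [Finset.insert_comm]
    rw [e1, e2]
    simp only [id]
    field_simp
    ring

end subsetExp

/-! ### Components and cuts of a finite multigraph

The multigraph has vertex type `V` and edge type `E`; the edge `e` joins `a e` and `b e`. -/

section graph

variable {V E : Type*} [Fintype V] [Fintype E] (a b : E → V)

/-- The edges with exactly one end in `S`. -/
def bdry (S : Finset V) : Finset E := {e | ¬(a e ∈ S ↔ b e ∈ S)}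

/-- The nonempty proper vertex sets. -/
def sides (V : Type*) [Fintype V] : Finset (Finset V) := {S | S.Nonempty ∧ S ≠ univ}

/-- Two vertices are related when edges of `A` connect them. -/
def conn (A : Finset E) : Setoid V :=
  Relation.EqvGen.setoid fun u v => ∃ e ∈ A, a e = u ∧ b e = v

/-- The number of connected components of the graph with edge set `A`. -/
def numComp (A : Finset E) : ℕ := Fintype.card (Quotient (conn a b A))

/-- The vertex set of a component. -/
def compSet (A : Finset E) (c : Quotient (conn a b A)) : Finset V :=
  {v | Quotient.mk (conn a b A) v = c}

/-- The edges that join different components of the graph with edge set `A`. -/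
def crossing (A : Finset E) : Finset E := {e | ¬ (conn a b A) (a e) (b e)}

variable {a b}

@[simp] lemma mem_bdry {S : Finset V} {e : E} : e ∈ bdry a b S ↔ ¬(a e ∈ S ↔ b e ∈ S) := by
  simp [bdry]

@[simp] lemma mem_sides {S : Finset V} : S ∈ sides V ↔ S.Nonempty ∧ S ≠ univ := by
  simp [sides]

lemma conn_edge {A : Finset E} {e : E} (he : e ∈ A) : (conn a b A) (a e) (b e) :=
  Relation.EqvGen.rel _ _ ⟨e, he, rfl, rfl⟩

lemma conn_mono {A B : Finset E} (h : A ⊆ B) : conn a b A ≤ conn a b B := by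
  intro u v huv
  have huv' : Relation.EqvGen (fun u v => ∃ e ∈ A, a e = u ∧ b e = v) u v := huv
  have hle : ∀ u v, (∃ e ∈ A, a e = u ∧ b e = v) → ∃ e ∈ B, a e = u ∧ b e = v :=
    fun _ _ ⟨e, he, h'⟩ => ⟨e, h he, h'⟩
  exact Relation.EqvGen.mono hle _ _ huv'

/-- A vertex set whose boundary avoids `A` is a union of components of `A`. -/
lemma mem_iff_of_conn {A : Finset E} {S : Finset V} (h : Disjoint A (bdry a b S)) {u v : V}
    (huv : (conn a b A) u v) : u ∈ S ↔ v ∈ S := by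
  have huv' : Relation.EqvGen (fun u v => ∃ e ∈ A, a e = u ∧ b e = v) u v := huv
  induction huv' with
  | rel x y hxy =>
    obtain ⟨e, he, rfl, rfl⟩ := hxy
    have := disjoint_left.1 h he
    simpa using this
  | refl x => rfl
  | symm x y h ih => exact (ih h).symm
  | trans x y z h1 h2 ih1 ih2 => exact (ih1 h1).trans (ih2 h2)

lemma numComp_insert_le (A : Finset E) (e : E) : numComp a b (insert e A) ≤ numComp a b A := by
  let f : Quotient (conn a b A) → Quotient (conn a b (insert e A)) :=
    Quotient.map' id (fun u v h => conn_mono (subset_insert e A) h)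
  have hf : Function.Surjective f := fun y => by
    induction y using Quotient.inductionOn with
    | h v => exact ⟨Quotient.mk _ v, rfl⟩
  exact Fintype.card_le_of_surjective f hf

lemma numComp_insert_lt {A : Finset E} {e : E} (he : e ∈ crossing a b A) :
    numComp a b (insert e A) + 1 ≤ numComp a b A := by
  let f : Quotient (conn a b A) → Quotient (conn a b (insert e A)) :=
    Quotient.map' id (fun u v h => conn_mono (subset_insert e A) h)
  have hf : Function.Surjective f := fun y => by
    induction y using Quotient.inductionOn with
    | h v => exact ⟨Quotient.mk _ v, rfl⟩
  refine Fintype.card_lt_of_surjective_not_injective f hf fun hinj => ?_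
  have h1 : f (Quotient.mk _ (a e)) = f (Quotient.mk _ (b e)) :=
    Quotient.sound (conn_edge (mem_insert_self e A))
  have h2 := Quotient.exact (hinj h1)
  simp only [crossing, mem_filter, mem_univ, true_and] at he
  exact he h2

lemma card_crossing_le_sum (U A : Finset E) :
    (#(U ∩ crossing a b A) : ℝ) ≤
      ∑ e ∈ U \ A, ((numComp a b A : ℝ) - numComp a b (insert e A)) := by
  have hsub : U ∩ crossing a b A ⊆ U \ A := by
    intro e he
    simp only [mem_inter, crossing, mem_filter, mem_univ, true_and] at he
    exact mem_sdiff.2 ⟨he.1, fun h => he.2 (conn_edge h)⟩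
  calc (#(U ∩ crossing a b A) : ℝ) = ∑ e ∈ U ∩ crossing a b A, (1 : ℝ) := by simp
    _ ≤ ∑ e ∈ U ∩ crossing a b A, ((numComp a b A : ℝ) - numComp a b (insert e A)) := by
        refine sum_le_sum fun e he => ?_
        have := numComp_insert_lt (mem_inter.1 he).2
        have : ((numComp a b (insert e A) : ℝ)) + 1 ≤ numComp a b A := by exact_mod_cast this
        linarith
    _ ≤ _ := by
        refine sum_le_sum_of_subset_of_nonneg hsub fun e _ _ => ?_
        have : ((numComp a b (insert e A) : ℝ)) ≤ numComp a b A := by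
          exact_mod_cast numComp_insert_le A e
        linarith

lemma sum_card_bdry_compSet_le (X A : Finset E) :
    ∑ c, #(X ∩ bdry a b (compSet a b A c)) ≤ 2 * #(X ∩ crossing a b A) := by
  have h : ∀ c, X ∩ bdry a b (compSet a b A c) ⊆
      {e ∈ X ∩ crossing a b A | Quotient.mk (conn a b A) (a e) = c ∨
        Quotient.mk (conn a b A) (b e) = c} := by
    intro c e he
    simp only [mem_inter, mem_bdry, compSet, mem_filter, mem_univ, true_and, crossing] at he ⊢
    refine ⟨⟨he.1, fun hc => he.2 ?_⟩, by tauto⟩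
    rw [show Quotient.mk (conn a b A) (a e) = Quotient.mk (conn a b A) (b e) from
      Quotient.sound hc]
  calc ∑ c, #(X ∩ bdry a b (compSet a b A c))
      ≤ ∑ c, ∑ e ∈ X ∩ crossing a b A, if Quotient.mk (conn a b A) (a e) = c ∨
        Quotient.mk (conn a b A) (b e) = c then 1 else 0 := by
        refine sum_le_sum fun c _ => ?_
        rw [← card_filter]
        exact card_le_card (h c)
    _ = ∑ e ∈ X ∩ crossing a b A, #{c | Quotient.mk (conn a b A) (a e) = c ∨
        Quotient.mk (conn a b A) (b e) = c} := by
        rw [sum_comm]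
        exact sum_congr rfl fun e _ => (card_filter _ _).symm
    _ ≤ ∑ e ∈ X ∩ crossing a b A, 2 := by
        refine sum_le_sum fun e _ => ?_
        calc _ ≤ #({Quotient.mk (conn a b A) (a e), Quotient.mk (conn a b A) (b e)} :
              Finset (Quotient (conn a b A))) := by
              refine card_le_card fun c hc => ?_
              simp only [mem_filter, mem_univ, true_and] at hc
              simp only [mem_insert, mem_singleton]
              tauto
          _ ≤ 2 := card_le_two
    _ = _ := by simp [mul_comm]

lemma compSet_injective (A : Finset E) : Function.Injective (compSet a b A) := by
  intro c d h
  induction c using Quotient.inductionOn with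
  | h v =>
    have : v ∈ compSet a b A (Quotient.mk _ v) := by simp [compSet]
    rw [h] at this
    simpa [compSet] using this

lemma disjoint_bdry_compSet (A : Finset E) (c : Quotient (conn a b A)) :
    Disjoint A (bdry a b (compSet a b A c)) := by
  rw [disjoint_left]
  intro e he
  simp only [mem_bdry, compSet, mem_filter, mem_univ, true_and, not_not]
  rw [show Quotient.mk (conn a b A) (a e) = Quotient.mk (conn a b A) (b e) from
    Quotient.sound (conn_edge he)]

lemma compSet_nonempty (A : Finset E) (c : Quotient (conn a b A)) :
    (compSet a b A c).Nonempty := by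
  induction c using Quotient.inductionOn with
  | h v => exact ⟨v, by simp [compSet]⟩

variable (a b) in
/-- The nonempty proper vertex sets with a boundary of size less than `D` that meets `F` in at
most `h` edges. -/
def lightSides (F : Finset E) (D h : ℝ) : Finset (Finset V) :=
  {S ∈ sides V | (#(bdry a b S) : ℝ) < D ∧ (#(F ∩ bdry a b S) : ℝ) ≤ h}

/-- Each component is the whole vertex set, or has at least `h` boundary edges in `F`, or is a light
cut that survives `A`, or has at least `D` boundary edges. -/
lemma mul_numComp_le {A F : Finset E} {D h : ℝ} (hD : 0 ≤ D) (hh : 0 < h) :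
    D * numComp a b A ≤
      D * (1 + 2 * #F / h + ∑ S ∈ lightSides a b F D h, if Disjoint A (bdry a b S) then 1 else 0)
        + 2 * (#(Fᶜ ∩ crossing a b A) + #F) := by
  have key : ∀ c, D ≤ D * ((if compSet a b A c = univ then 1 else 0) +
      #(F ∩ bdry a b (compSet a b A c)) / h +
      (if compSet a b A c ∈ lightSides a b F D h then 1 else 0)) +
      #(univ ∩ bdry a b (compSet a b A c)) := by
    intro c
    rw [univ_inter]
    have h1 : (0 : ℝ) ≤ #(F ∩ bdry a b (compSet a b A c)) / h := by positivity
    have h2 : (0 : ℝ) ≤ (if compSet a b A c ∈ lightSides a b F D h then 1 else 0) := by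
      split_ifs <;> norm_num
    have h3 : (0 : ℝ) ≤ (if compSet a b A c = univ then 1 else 0) := by
      split_ifs <;> norm_num
    have h4 : (0 : ℝ) ≤ #(bdry a b (compSet a b A c)) := by positivity
    by_cases hu : compSet a b A c = univ
    · rw [if_pos hu] at *
      nlinarith [mul_nonneg hD h1, mul_nonneg hD h2]
    by_cases hl : compSet a b A c ∈ lightSides a b F D h
    · rw [if_pos hl] at *
      nlinarith [mul_nonneg hD h1, mul_nonneg hD h3]
    have hs : compSet a b A c ∈ sides V := mem_sides.2 ⟨compSet_nonempty A c, hu⟩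
    simp only [lightSides, mem_filter, hs, true_and, not_and_or, not_lt, not_le] at hl
    rcases hl with hl | hl
    · nlinarith [mul_nonneg hD h1, mul_nonneg hD h2, mul_nonneg hD h3]
    · have : 1 ≤ (#(F ∩ bdry a b (compSet a b A c)) : ℝ) / h := by
        rw [le_div_iff₀ hh]; linarith
      nlinarith [mul_nonneg hD h2, mul_nonneg hD h3, mul_le_mul_of_nonneg_left this hD]
  have hsum := sum_le_sum fun c (_ : c ∈ univ) => key c
  rw [sum_const, card_univ, nsmul_eq_mul, sum_add_distrib, ← mul_sum, sum_add_distrib,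
    sum_add_distrib, ← sum_div] at hsum
  have s1 : ∑ c, (if compSet a b A c = univ then 1 else 0 : ℝ) ≤ 1 := by
    rw [sum_boole]
    have : #{c | compSet a b A c = univ} ≤ 1 := by
      rw [card_le_one]
      intro c hc d hd
      simp only [mem_filter, mem_univ, true_and] at hc hd
      exact compSet_injective A (hc.trans hd.symm)
    exact_mod_cast this
  have s2 : ∑ c, (#(F ∩ bdry a b (compSet a b A c)) : ℝ) ≤ 2 * #F := by
    have h1 := sum_card_bdry_compSet_le (a := a) (b := b) F A
    have h2 : #(F ∩ crossing a b A) ≤ #F := card_le_card inter_subset_left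
    exact_mod_cast h1.trans (by omega)
  have s3 : ∑ c, (if compSet a b A c ∈ lightSides a b F D h then 1 else 0 : ℝ) ≤
      ∑ S ∈ lightSides a b F D h, if Disjoint A (bdry a b S) then 1 else 0 := by
    rw [sum_boole, sum_boole]
    norm_cast
    refine card_le_card_of_injOn (compSet a b A) ?_ (compSet_injective A).injOn
    intro c hc
    simp only [coe_filter, mem_univ, true_and, Set.mem_ofPred_eq] at hc ⊢
    exact ⟨hc, disjoint_bdry_compSet A c⟩
  have s4 : ∑ c, (#(univ ∩ bdry a b (compSet a b A c)) : ℝ) ≤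
      2 * (#(Fᶜ ∩ crossing a b A) + #F) := by
    have h1 := sum_card_bdry_compSet_le (a := a) (b := b) univ A
    have h2 : #(univ ∩ crossing a b A) ≤ #(Fᶜ ∩ crossing a b A) + #F := by
      rw [univ_inter]
      refine (card_le_card ?_).trans (card_union_le _ _)
      intro e he
      by_cases h : e ∈ F <;> simp [h, he]
    exact_mod_cast h1.trans (by omega)
  have s2' : (∑ c, (#(F ∩ bdry a b (compSet a b A c)) : ℝ)) / h ≤ 2 * #F / h := by gcongr
  unfold numComp
  calc D * (Fintype.card (Quotient (conn a b A)) : ℝ)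
      = Fintype.card (Quotient (conn a b A)) * D := mul_comm _ _
    _ ≤ _ := hsum
    _ ≤ _ := by gcongr

end graph


section graph

variable {V E : Type*} [Fintype V] [Fintype E] {a b : E → V}

/-! ### The contraction process after deletion of an edge set -/

lemma numComp_le_card (A : Finset E) : numComp a b A ≤ Fintype.card V :=
  Fintype.card_quotient_le _

variable (a b) in
/-- The expected number of components when the edges of `F` are deleted and every other edge fails
independently with probability `exp (-θ * T)`. -/
def expNumComp (F : Finset E) (T θ : ℝ) : ℝ :=
  subsetExp (Real.exp (-θ * T)) Fᶜ fun A => numComp a b A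

/-- A light cut survives the deletion of `F` almost independently of `F`, so the expected number of
surviving light cuts is controlled by the expected number of failed cuts. -/
lemma subsetExp_lightSides_le {F : Finset E} {D h T θ : ℝ} (hT : 0 ≤ T) (h1 : θ ≤ 1) :
    subsetExp (Real.exp (-θ * T)) Fᶜ
        (fun A => ∑ S ∈ lightSides a b F D h, if Disjoint A (bdry a b S) then 1 else 0) ≤
      Real.exp (T * (h + (1 - θ) * D)) * ∑ S ∈ sides V, Real.exp (-T * #(bdry a b S)) := by
  rw [subsetExp_sum, mul_sum]
  refine (sum_le_sum fun S hS => ?_).trans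
    (sum_le_sum_of_subset_of_nonneg (filter_subset _ _) fun _ _ _ => by positivity)
  simp only [lightSides, mem_filter] at hS
  obtain ⟨-, hS1, hS2⟩ := hS
  have hc : (#(Fᶜ ∩ bdry a b S) : ℝ) = #(bdry a b S) - #(F ∩ bdry a b S) := by
    have : #(bdry a b S) = #(F ∩ bdry a b S) + #(Fᶜ ∩ bdry a b S) := by
      rw [← card_union_of_disjoint]
      · congr 1; ext e; simp; tauto
      · rw [disjoint_left]; intro e; simp; tauto
    rw [this]; push_cast; ring
  rw [subsetExp_disjoint _ _ _ (fun _ => 1), subsetExp_const, mul_one, ← Real.exp_nat_mul,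
    ← Real.exp_add]
  apply Real.exp_le_exp.2
  rw [hc]
  have e1 : (1 - θ) * #(bdry a b S) ≤ (1 - θ) * D := mul_le_mul_of_nonneg_left hS1.le (by linarith)
  have e2 : θ * #(F ∩ bdry a b S) ≤ h :=
    (mul_le_of_le_one_left (by positivity) h1).trans hS2
  nlinarith [mul_le_mul_of_nonneg_left (add_le_add e1 e2) hT]

/-- The differential inequality for the expected number of components. -/
lemma exists_hasDerivAt_expNumComp {F : Finset E} {T N θ α β : ℝ} (hT : 0 < T) (hN : 0 < N)
    (hsum : ∑ S ∈ sides V, Real.exp (-T * #(bdry a b S)) ≤ 2 * Real.exp (-N))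
    (hF : T * #F = β * N) (hβ : 0 ≤ β) (hα : 2 ≤ α) (h0 : 0 ≤ θ) (h1 : θ ≤ 1) :
    ∃ R', HasDerivAt (expNumComp a b F T) R' θ ∧
      R' ≤ -(α * N / 2) * (expNumComp a b F T θ - (1 + 41 * β) -
        2 * Real.exp (N * (-1 + 1 / 20 + α * (1 - θ)))) := by
  set q := Real.exp (-θ * T) with hq
  have hq0 : 0 < q := Real.exp_pos _
  have hq1 : q ≤ 1 := by
    rw [hq, Real.exp_le_one_iff]; nlinarith
  have hd := hasDerivAt_subsetExp Fᶜ q hq0.ne' (fun A => (numComp a b A : ℝ))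
  have hd1 : HasDerivAt (fun θ : ℝ => Real.exp (-θ * T)) (q * (-1 * T)) θ :=
    (((hasDerivAt_id θ).neg).mul_const T).exp
  have hd2 : HasDerivAt (expNumComp a b F T) _ θ := hd.comp_of_eq θ hd1 rfl
  refine ⟨_, hd2, ?_⟩
  -- light cuts have fewer than `D` edges; heavy components have at least `h` boundary edges in `F`
  set D := α * N / T with hD
  set h := N / T / 20 with hh
  have hDpos : 0 < D := by positivity
  have hhpos : 0 < h := by positivity
  set M := subsetExp q Fᶜ (fun A => ∑ e ∈ Fᶜ \ A,
    ((numComp a b A : ℝ) - numComp a b (insert e A))) with hM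
  set L := subsetExp q Fᶜ
        (fun A => ∑ S ∈ lightSides a b F D h, if Disjoint A (bdry a b S) then (1 : ℝ) else 0) with hL
  have hLle : L ≤ 2 * Real.exp (N * (-1 + 1 / 20 + α * (1 - θ))) := by
    have := subsetExp_lightSides_le (a := a) (b := b) (F := F) (D := D) (h := h) hT.le h1
    have h3 : Real.exp (T * (h + (1 - θ) * D)) * (2 * Real.exp (-N)) =
        2 * Real.exp (N * (-1 + 1 / 20 + α * (1 - θ))) := by
      rw [mul_left_comm, ← Real.exp_add]
      congr 2
      rw [hh, hD]; field_simp; ring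
    exact this.trans ((mul_le_mul_of_nonneg_left hsum (Real.exp_pos _).le).trans_eq h3)
  have hmain : D * expNumComp a b F T θ ≤ D * (1 + 2 * #F / h + L) + 2 * (M + #F) := by
    have := subsetExp_mono (q := q) (U := Fᶜ) hq0.le hq1
      (f := fun A => D * numComp a b A)
      (g := fun A => (D * (1 + 2 * #F / h) + 2 * #F) +
        (D * (∑ S ∈ lightSides a b F D h, if Disjoint A (bdry a b S) then 1 else 0) +
        2 * ∑ e ∈ Fᶜ \ A, ((numComp a b A : ℝ) - numComp a b (insert e A)))) (by
          intro A _
          have e1 := mul_numComp_le (a := a) (b := b) (A := A) (F := F) hDpos.le hhpos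
          have e2 := card_crossing_le_sum (a := a) (b := b) Fᶜ A
          linarith)
    rw [subsetExp_const_mul, subsetExp_add, subsetExp_const, subsetExp_add, subsetExp_const_mul,
      subsetExp_const_mul] at this
    calc _ ≤ _ := this
      _ = _ := by ring
  have hFh : 2 * (#F : ℝ) / h = 40 * β := by
    rw [hh, div_eq_iff (by positivity)]
    field_simp
    linarith
  have hR' : q⁻¹ * M * (q * (-1 * T)) = - (T * M) := by field_simp
  rw [hR']
  rw [hFh] at hmain
  have hTD : T * D = α * N := by rw [hD]; field_simp
  set R := expNumComp a b F T θ
  have h4 : T * (D * R) ≤ T * (D * (1 + 40 * β + L) + 2 * (M + #F)) :=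
    mul_le_mul_of_nonneg_left hmain hT.le
  have h5 : α * N * R ≤ α * N * (1 + 40 * β + L) + 2 * (T * M) + 2 * (β * N) := by
    rw [← hTD, ← hF]; linarith
  have h6 : α * N * L ≤ α * N * (2 * Real.exp (N * (-1 + 1 / 20 + α * (1 - θ)))) :=
    mul_le_mul_of_nonneg_left hLle (by positivity)
  have h7 : 2 * (β * N) ≤ α * (β * N) := mul_le_mul_of_nonneg_right hα (by positivity)
  linarith

/-- The integrated form of the differential inequality. -/
lemma antitoneOn_expNumComp {F : Finset E} {T N α β : ℝ} (hT : 0 < T) (hN : 0 < N)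
    (hsum : ∑ S ∈ sides V, Real.exp (-T * #(bdry a b S)) ≤ 2 * Real.exp (-N))
    (hF : T * #F = β * N) (hβ : 0 ≤ β) (hα : 2 ≤ α) :
    AntitoneOn (fun θ => Real.exp (α * N / 2 * θ) * (expNumComp a b F T θ - (1 + 41 * β)) +
      2 * Real.exp (N * (-1 + 1 / 20 + α) - α * N / 2 * θ)) (Set.Icc 0 1) := by
  choose! R' hR' hle using fun (θ : ℝ) (h : θ ∈ Set.Icc (0 : ℝ) 1) =>
    exists_hasDerivAt_expNumComp (a := a) (b := b) hT hN hsum hF hβ hα h.1 h.2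
  have hderiv : ∀ θ ∈ Set.Icc (0 : ℝ) 1, HasDerivAt
      (fun θ => Real.exp (α * N / 2 * θ) * (expNumComp a b F T θ - (1 + 41 * β)) +
        2 * Real.exp (N * (-1 + 1 / 20 + α) - α * N / 2 * θ))
      (Real.exp (α * N / 2 * θ) * (α * N / 2 * 1) * (expNumComp a b F T θ - (1 + 41 * β)) +
        Real.exp (α * N / 2 * θ) * R' θ +
        2 * (Real.exp (N * (-1 + 1 / 20 + α) - α * N / 2 * θ) * -(α * N / 2 * 1))) θ := by
    intro θ hθ
    have h1 : HasDerivAt (fun θ : ℝ => α * N / 2 * θ) (α * N / 2 * 1) θ :=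
      (hasDerivAt_id θ).const_mul _
    exact (h1.exp.mul ((hR' θ hθ).sub_const _)).add
      (((h1.const_sub _).exp).const_mul 2)
  refine antitoneOn_of_deriv_nonpos (convex_Icc 0 1)
    (fun θ hθ => (hderiv θ hθ).continuousAt.continuousWithinAt)
    (fun θ hθ => (hderiv θ (interior_subset hθ)).differentiableAt.differentiableWithinAt) ?_
  intro θ hθ
  have hθ' := interior_subset hθ
  rw [(hderiv θ hθ').deriv]
  have h2 := mul_le_mul_of_nonneg_left (hle θ hθ') (Real.exp_pos (α * N / 2 * θ)).le
  have h3 : Real.exp (N * (-1 + 1 / 20 + α) - α * N / 2 * θ) =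
      Real.exp (α * N / 2 * θ) * Real.exp (N * (-1 + 1 / 20 + α * (1 - θ))) := by
    rw [← Real.exp_add]; congr 1; ring
  rw [h3]
  linarith

/-- After deletion of an edge set of size `β * N / T`, the contraction leaves `O(β)` components on
average. -/
lemma expNumComp_le {F : Finset E} {T N β : ℝ} (hT : 0 < T) (hN : 40 ≤ N)
    (hV : (Fintype.card V : ℝ) = Real.exp N)
    (hsum : ∑ S ∈ sides V, Real.exp (-T * #(bdry a b S)) ≤ 2 * Real.exp (-N))
    (hF : T * #F = β * N) (hβ : 0 ≤ β) :
    expNumComp a b F T (9 / 10) ≤ 2 + 41 * β := by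
  have hN0 : 0 < N := by linarith
  have hstart : expNumComp a b F T 0 ≤ Real.exp N := by
    have := subsetExp_mono (q := Real.exp (-0 * T)) (U := Fᶜ) (Real.exp_pos _).le (by simp)
      (f := fun A => (numComp a b A : ℝ)) (g := fun _ => Real.exp N)
      (fun A _ => by rw [← hV]; exact_mod_cast numComp_le_card A)
    rwa [subsetExp_const] at this
  -- `α = 2` up to `θ = 1 / 2` brings the excess over `1 + 41 * β` down to `3 * n ^ (11 / 20)`
  have p1 := antitoneOn_expNumComp (a := a) (b := b) hT hN0 hsum hF hβ (le_refl (2 : ℝ))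
    (show (0 : ℝ) ∈ Set.Icc 0 1 by norm_num) (show (1 / 2 : ℝ) ∈ Set.Icc 0 1 by norm_num)
    (by norm_num)
  -- `α = 3` from there to `θ = 9 / 10` brings it down to `5 * n ^ (-1 / 20)`
  have p2 := antitoneOn_expNumComp (a := a) (b := b) hT hN0 hsum hF hβ
    (show (2 : ℝ) ≤ 3 by norm_num)
    (show (1 / 2 : ℝ) ∈ Set.Icc 0 1 by norm_num) (show (9 / 10 : ℝ) ∈ Set.Icc 0 1 by norm_num)
    (by norm_num)
  beta_reduce at p1 p2
  set R₁ := expNumComp a b F T (1 / 2) - (1 + 41 * β)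
  set R₂ := expNumComp a b F T (9 / 10) - (1 + 41 * β) with hR₂
  have e1 : Real.exp (N * (-1 + 1 / 20 + 2) - 2 * N / 2 * 0) = Real.exp (21 / 20 * N) := by
    congr 1; ring
  have e2 : Real.exp (2 * N / 2 * 0) = 1 := by simp
  have e3 : Real.exp (2 * N / 2 * (1 / 2)) = Real.exp (N / 2) := by congr 1; ring
  have e4 : Real.exp (3 * N / 2 * (1 / 2)) = Real.exp (N / 4) * Real.exp (N / 2) := by
    rw [← Real.exp_add]; congr 1; ring
  have e5 : Real.exp (N * (-1 + 1 / 20 + 3) - 3 * N / 2 * (1 / 2)) =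
      Real.exp (N / 4) * Real.exp (21 / 20 * N) := by
    rw [← Real.exp_add]; congr 1; ring
  have e6 : Real.exp (3 * N / 2 * (9 / 10)) =
      Real.exp (N / 4) * Real.exp (21 / 20 * N) * Real.exp (N / 20) := by
    rw [← Real.exp_add, ← Real.exp_add]; congr 1; ring
  rw [e1, e2, e3] at p1
  rw [e4, e5, e6] at p2
  have q1 : Real.exp (N / 2) * R₁ ≤ 3 * Real.exp (21 / 20 * N) := by
    have h1 : Real.exp N ≤ Real.exp (21 / 20 * N) := Real.exp_le_exp.2 (by linarith)
    have h2 := Real.exp_pos (N * (-1 + 1 / 20 + 2) - 2 * N / 2 * (1 / 2))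
    linarith
  set X := Real.exp (N / 4) * Real.exp (21 / 20 * N) with hX
  have hXpos : 0 < X := by positivity
  have q2 : X * Real.exp (N / 20) * R₂ ≤ X * 5 := by
    have h1 := mul_le_mul_of_nonneg_left q1 (Real.exp_pos (N / 4)).le
    have h2 := Real.exp_pos (N * (-1 + 1 / 20 + 3) - 3 * N / 2 * (9 / 10))
    linarith
  have q3 : Real.exp (N / 20) * R₂ ≤ 5 := by
    rw [mul_assoc] at q2
    exact le_of_mul_le_mul_left q2 hXpos
  have q4 : 5 ≤ Real.exp (N / 20) := by
    have h1 : (2.7 : ℝ) ≤ Real.exp 1 := by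
      have := Real.exp_one_gt_d9; linarith
    have h2 : Real.exp 2 = Real.exp 1 * Real.exp 1 := by rw [← Real.exp_add]; norm_num
    have h3 : Real.exp 2 ≤ Real.exp (N / 20) := Real.exp_le_exp.2 (by linarith)
    nlinarith
  have q5 : R₂ ≤ 1 := by
    by_contra hcon
    push Not at hcon
    nlinarith
  linarith

/-- With probability at least one half the contraction leaves few components, by Markov's
inequality and `2 + 41 * β ≤ 43 * β`. -/
lemma one_le_two_mul_subsetExp {F : Finset E} {T N β : ℝ} (hT : 0 < T) (hN : 40 ≤ N)
    (hV : (Fintype.card V : ℝ) = Real.exp N)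
    (hsum : ∑ S ∈ sides V, Real.exp (-T * #(bdry a b S)) ≤ 2 * Real.exp (-N))
    (hF : T * #F = β * N) (hβ : 1 ≤ β) :
    1 ≤ 2 * subsetExp (Real.exp (-(9 / 10) * T)) Fᶜ
      (fun A => if (numComp a b A : ℝ) ≤ 86 * β then 1 else 0) := by
  have h1 := expNumComp_le (a := a) (b := b) hT hN hV hsum hF (by linarith)
  have h2 := subsetExp_mono (q := Real.exp (-(9 / 10) * T)) (U := Fᶜ) (Real.exp_pos _).le
    (by rw [Real.exp_le_one_iff]; linarith)
    (f := fun A => 86 * β + (-(86 * β)) * (if (numComp a b A : ℝ) ≤ 86 * β then 1 else 0))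
    (g := fun A => (numComp a b A : ℝ)) (fun A _ => by
      split_ifs with h
      · simp
      · linarith)
  rw [subsetExp_add, subsetExp_const, subsetExp_const_mul] at h2
  change _ ≤ expNumComp a b F T (9 / 10) at h2
  nlinarith

end graph


section graph

variable {V E : Type*} [Fintype V] [Fintype E] {a b : E → V}

/-! ### Pairs of cuts -/

variable (a b) in
/-- The ordered pairs of nonempty proper vertex sets with distinct boundaries. -/
def sidePairs : Finset (Finset V × Finset V) :=
  {P ∈ sides V ×ˢ sides V | bdry a b P.1 ≠ bdry a b P.2}

lemma bdry_symmDiff (S S' : Finset V) :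
    bdry a b (symmDiff S S') = symmDiff (bdry a b S) (bdry a b S') := by
  ext e
  simp only [mem_bdry, mem_symmDiff]
  tauto

lemma bdry_compl (S : Finset V) : bdry a b Sᶜ = bdry a b S := by
  ext e
  simp only [mem_bdry, mem_compl]
  tauto

lemma compl_mem_sides {S : Finset V} (hS : S ∈ sides V) : Sᶜ ∈ sides V := by
  rw [mem_sides] at hS ⊢
  refine ⟨?_, ?_⟩
  · rw [nonempty_iff_ne_empty, Ne, compl_eq_empty_iff]; exact hS.2
  · rw [Ne, compl_eq_univ_iff]; exact hS.1.ne_empty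

lemma symmDiff_mem_sides {S S' : Finset V} (h : bdry a b S ≠ bdry a b S') :
    symmDiff S S' ∈ sides V := by
  rw [mem_sides]
  constructor
  · rw [nonempty_iff_ne_empty]
    intro h0
    exact h (by rw [symmDiff_eq_bot.1 h0])
  · intro h0
    have : S' = Sᶜ := by
      ext v
      have : v ∈ symmDiff S S' := by rw [h0]; exact mem_univ v
      rw [mem_symmDiff] at this
      rw [mem_compl]; tauto
    exact h (by rw [this, bdry_compl])

/-- In a connected graph, a vertex set is determined by its boundary up to complementation. -/
lemma eq_or_forall_mem_iff_notMem {S S' : Finset V}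
    (hconn : ∀ X ∈ sides V, bdry a b X ≠ ∅) (h : bdry a b S' = bdry a b S) :
    S' = S ∨ ∀ v, v ∈ S' ↔ v ∉ S := by
  have h0 : symmDiff S S' ∉ sides V := fun hs => hconn _ hs (by
    rw [bdry_symmDiff, h, symmDiff_self]; rfl)
  rw [mem_sides, not_and_or, not_nonempty_iff_eq_empty, not_not] at h0
  rcases h0 with h0 | h0
  · exact Or.inl (symmDiff_eq_bot.1 h0).symm
  · right
    intro v
    have : v ∈ symmDiff S S' := by rw [h0]; exact mem_univ v
    rw [mem_symmDiff] at this
    tauto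

/-- Every edge of `C ∪ D` lies in exactly two of `C`, `D` and `C ∆ D`. -/
lemma card_add_card_add_card_symmDiff (C D : Finset E) :
    #C + #D + #(symmDiff C D) = 2 * #(C ∪ D) := by
  have h1 := card_union_add_card_inter C D
  have h2 : #(symmDiff C D) + #(C ∩ D) = #(C ∪ D) := by
    rw [← card_union_of_disjoint]
    · congr 1; ext e; simp only [mem_union, mem_symmDiff, mem_inter]; tauto
    · rw [disjoint_left]; intro e; simp only [mem_symmDiff, mem_inter]; tauto
  omega

lemma card_unions_of_components_le (A : Finset E) :
    #{S : Finset V | Disjoint A (bdry a b S)} ≤ 2 ^ numComp a b A := by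
  have : 2 ^ numComp a b A = #(univ : Finset (Finset (Quotient (conn a b A)))) := by
    rw [card_univ, Fintype.card_finset, numComp]
  rw [this]
  refine card_le_card_of_injOn (fun S => S.image (Quotient.mk (conn a b A)))
    (fun _ _ => mem_coe.2 (mem_univ _)) ?_
  intro S hS S' hS' h
  simp only [coe_filter, mem_univ, true_and, Set.mem_ofPred_eq] at hS hS'
  have key : ∀ {X : Finset V}, Disjoint A (bdry a b X) → ∀ v,
      v ∈ X ↔ Quotient.mk (conn a b A) v ∈ X.image (Quotient.mk (conn a b A)) := by
    intro X hX v
    constructor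
    · exact mem_image_of_mem _
    · intro hv
      obtain ⟨u, hu, huv⟩ := mem_image.1 hv
      exact (mem_iff_of_conn hX (Quotient.exact huv)).1 hu
  ext v
  beta_reduce at h
  rw [key hS, key hS', h]

/-- A fixed contraction with few components: the surviving pairs of cuts weigh much less than the
surviving cuts. The weight of a pair is at most the geometric mean of the weights of `C`, `D` and
`C ∆ D` raised to the power `3 / 2`; one third of this exponent outweighs the number `4 ^ r` of
pairs, and the other two thirds leave the weight of a single cut. -/
lemma sum_sidePairs_le {T N : ℝ} (hT : 0 < T) (hN : 10000 ≤ N)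
    (hmin : ∀ S ∈ sides V, N ≤ T * #(bdry a b S)) (A : Finset E) :
    ∑ P ∈ sidePairs a b, (if Disjoint A (bdry a b P.1 ∪ bdry a b P.2) then
        if (numComp a b A : ℝ) ≤ 86 * (T * #(bdry a b P.1 ∪ bdry a b P.2) / N) then
          Real.exp (-(T / 10) * #(bdry a b P.1 ∪ bdry a b P.2)) else 0 else 0) ≤
      Real.exp (-(N / 60)) *
        ∑ S ∈ sides V, if Disjoint A (bdry a b S) then Real.exp (-(T / 10) * #(bdry a b S))
          else 0 := by
  set z := ∑ S ∈ sides V, if Disjoint A (bdry a b S) then Real.exp (-(T / 10) * #(bdry a b S))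
          else 0 with hz
  set r := numComp a b A with hr
  have hz0 : 0 ≤ z := sum_nonneg fun S _ => by split_ifs <;> positivity
  have hzS : ∀ S ∈ sides V, Disjoint A (bdry a b S) →
      Real.exp (-(T / 10) * #(bdry a b S)) ≤ z := by
    intro S hS hd
    have := single_le_sum (f := fun S => if Disjoint A (bdry a b S) then
      Real.exp (-(T / 10) * #(bdry a b S)) else 0)
      (fun S _ => by split_ifs <;> positivity) hS
    beta_reduce at this
    rwa [if_pos hd] at this
  set c := Real.exp (-(N / 60)) * Real.exp (-(N / 5160 * r)) with hc
  have hterm : ∀ P ∈ sidePairs a b,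
      (if Disjoint A (bdry a b P.1 ∪ bdry a b P.2) then
        if (r : ℝ) ≤ 86 * (T * #(bdry a b P.1 ∪ bdry a b P.2) / N) then
          Real.exp (-(T / 10) * #(bdry a b P.1 ∪ bdry a b P.2)) else 0 else 0) ≤
      if Disjoint A (bdry a b P.1 ∪ bdry a b P.2) then c * z else 0 := by
    intro P hP
    split_ifs with hd hβ
    · simp only [sidePairs, mem_filter, mem_product] at hP
      obtain ⟨⟨h1, h2⟩, hne⟩ := hP
      set F := bdry a b P.1 ∪ bdry a b P.2 with hF
      obtain ⟨d1, d2⟩ := disjoint_union_right.1 hd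
      have d3 : Disjoint A (bdry a b (symmDiff P.1 P.2)) := by
        refine hd.mono_right ?_
        rw [bdry_symmDiff]
        exact symmDiff_le_sup
      have z1 := hzS _ h1 d1
      have z2 := hzS _ h2 d2
      have z3 := hzS _ (symmDiff_mem_sides hne) d3
      have hzpos : 0 < z := (Real.exp_pos _).trans_le z1
      have hcard := card_add_card_add_card_symmDiff (bdry a b P.1) (bdry a b P.2)
      rw [← bdry_symmDiff, ← hF] at hcard
      have hcard' : (#(bdry a b P.1) : ℝ) + #(bdry a b P.2) +
          #(bdry a b (symmDiff P.1 P.2)) = 2 * #F := by exact_mod_cast hcard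
      have hFmin : N ≤ T * #F := by
        refine (hmin _ h1).trans (mul_le_mul_of_nonneg_left ?_ hT.le)
        exact_mod_cast card_le_card subset_union_left
      have hFr : (r : ℝ) * N ≤ 86 * (T * #F) := by
        rw [← mul_div_assoc, le_div_iff₀ (by linarith)] at hβ
        exact hβ
      rw [← Real.le_log_iff_exp_le hzpos] at z1 z2 z3
      rw [hc, ← Real.exp_add, ← Real.exp_log hzpos, ← Real.exp_add]
      apply Real.exp_le_exp.2
      -- two thirds of the exponent give `log z`, the rest gives `c`
      have hw : -(T / 10) * (2 * #F) ≤ 3 * Real.log z := by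
        rw [← hcard']; linarith
      linarith
    · exact mul_nonneg (by positivity) hz0
    · exact le_rfl
  refine (sum_le_sum hterm).trans ?_
  rw [← sum_filter, sum_const, nsmul_eq_mul]
  have hcount : (#{P ∈ sidePairs a b | Disjoint A (bdry a b P.1 ∪ bdry a b P.2)} : ℝ) ≤
      4 ^ r := by
    have h1 : #{P ∈ sidePairs a b | Disjoint A (bdry a b P.1 ∪ bdry a b P.2)} ≤
        #(({S | Disjoint A (bdry a b S)} : Finset (Finset V)) ×ˢ
          ({S | Disjoint A (bdry a b S)} : Finset (Finset V))) := by
      refine card_le_card fun P hP => ?_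
      rw [mem_filter, disjoint_union_right] at hP
      simpa using hP.2
    have h2 := card_unions_of_components_le (a := a) (b := b) A
    rw [card_product] at h1
    have h3 := h1.trans (Nat.mul_le_mul h2 h2)
    rw [← mul_pow] at h3
    exact_mod_cast h3
  -- `N ≥ 10000` serves to make `exp (N / 5160)` exceed `4`
  have h4 : (4 : ℝ) ^ r * Real.exp (-(N / 5160 * r)) ≤ 1 := by
    have : (4 : ℝ) ≤ Real.exp (N / 5160) := by
      have e1 : (2.7 : ℝ) ≤ Real.exp 1 := by
        have := Real.exp_one_gt_d9; linarith
      have e2 : Real.exp (3 / 2) * Real.exp (3 / 2) = Real.exp 1 * Real.exp 1 * Real.exp 1 := by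
        rw [← Real.exp_add, ← Real.exp_add, ← Real.exp_add]; norm_num
      have e3 : (19 : ℝ) ≤ Real.exp 1 * Real.exp 1 * Real.exp 1 := by
        have : (7.2 : ℝ) ≤ Real.exp 1 * Real.exp 1 := by nlinarith
        nlinarith
      have e4 : (4 : ℝ) ≤ Real.exp (3 / 2) := by
        by_contra hcon
        push Not at hcon
        nlinarith [Real.exp_pos (3 / 2)]
      exact e4.trans (Real.exp_le_exp.2 (by linarith))
    rw [Real.exp_neg, mul_comm (N / 5160), Real.exp_nat_mul, ← div_eq_mul_inv,
      div_le_one (by positivity)]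
    gcongr
  calc _ ≤ 4 ^ r * (c * z) := mul_le_mul_of_nonneg_right hcount (mul_nonneg (by positivity) hz0)
    _ = (4 ^ r * Real.exp (-(N / 5160 * r))) * (Real.exp (-(N / 60)) * z) := by rw [hc]; ring
    _ ≤ 1 * (Real.exp (-(N / 60)) * z) :=
        mul_le_mul_of_nonneg_right h4 (mul_nonneg (by positivity) hz0)
    _ = _ := one_mul _

/-- The bound on pairs of cuts, with `exp (-T)` for the failure probability: the edges fail in two
rounds, with probabilities `exp (-(9 / 10) * T)` and `exp (-(T / 10))`, and `sum_sidePairs_le` is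
applied to the contraction that the first round leaves. -/
lemma sum_exp_sidePairs_le {T N : ℝ} (hT : 0 < T) (hN : 10000 ≤ N)
    (hV : (Fintype.card V : ℝ) = Real.exp N)
    (hmin : ∀ S ∈ sides V, N ≤ T * #(bdry a b S))
    (hsum : ∑ S ∈ sides V, Real.exp (-T * #(bdry a b S)) ≤ 2 * Real.exp (-N)) :
    ∑ P ∈ sidePairs a b, Real.exp (-T * #(bdry a b P.1 ∪ bdry a b P.2)) ≤
      2 * Real.exp (-(N / 60)) * ∑ S ∈ sides V, Real.exp (-T * #(bdry a b S)) := by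
  set q := Real.exp (-(9 / 10) * T) with hq
  have hsplit : ∀ k : ℕ, Real.exp (-T * k) = q ^ k * Real.exp (-(T / 10) * k) := by
    intro k
    rw [hq, ← Real.exp_nat_mul, ← Real.exp_add]; congr 1; ring
  have h1 : ∀ P ∈ sidePairs a b, Real.exp (-T * #(bdry a b P.1 ∪ bdry a b P.2)) ≤
      2 * subsetExp q univ (fun A => if Disjoint A (bdry a b P.1 ∪ bdry a b P.2) then
        if (numComp a b A : ℝ) ≤ 86 * (T * #(bdry a b P.1 ∪ bdry a b P.2) / N) then
          Real.exp (-(T / 10) * #(bdry a b P.1 ∪ bdry a b P.2)) else 0 else 0) := by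
    intro P hP
    simp only [sidePairs, mem_filter, mem_product] at hP
    obtain ⟨⟨hP1, -⟩, -⟩ := hP
    set F := bdry a b P.1 ∪ bdry a b P.2 with hF
    have hFmin : N ≤ T * #F := by
      refine (hmin _ hP1).trans (mul_le_mul_of_nonneg_left ?_ hT.le)
      exact_mod_cast card_le_card subset_union_left
    have hprob := one_le_two_mul_subsetExp (a := a) (b := b) (F := F) (β := T * #F / N) hT
      (by linarith) hV hsum (by field_simp) (by rw [le_div_iff₀ (by linarith)]; linarith)
    rw [subsetExp_disjoint, univ_inter, ← compl_eq_univ_sdiff]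
    have e : subsetExp q Fᶜ (fun A => if (numComp a b A : ℝ) ≤ 86 * (T * #F / N) then
        Real.exp (-(T / 10) * #F) else 0) = Real.exp (-(T / 10) * #F) *
        subsetExp q Fᶜ (fun A => if (numComp a b A : ℝ) ≤ 86 * (T * #F / N) then 1 else 0) := by
      rw [← subsetExp_const_mul]
      congr 1
      funext A
      split_ifs <;> simp
    rw [e, hsplit]
    have hpos : 0 < q ^ #F * Real.exp (-(T / 10) * #F) := by positivity
    nlinarith [mul_le_mul_of_nonneg_left hprob hpos.le]
  have hq1 : q ≤ 1 := by rw [hq, Real.exp_le_one_iff]; linarith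
  calc _ ≤ _ := sum_le_sum h1
    _ = 2 * subsetExp q univ (fun A => ∑ P ∈ sidePairs a b,
        (if Disjoint A (bdry a b P.1 ∪ bdry a b P.2) then
        if (numComp a b A : ℝ) ≤ 86 * (T * #(bdry a b P.1 ∪ bdry a b P.2) / N) then
          Real.exp (-(T / 10) * #(bdry a b P.1 ∪ bdry a b P.2)) else 0 else 0)) := by
        rw [subsetExp_sum, mul_sum]
    _ ≤ 2 * subsetExp q univ (fun A => Real.exp (-(N / 60)) *
        ∑ S ∈ sides V, if Disjoint A (bdry a b S) then Real.exp (-(T / 10) * #(bdry a b S))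
          else 0) := by
        refine mul_le_mul_of_nonneg_left (subsetExp_mono (Real.exp_pos _).le hq1
          fun A _ => sum_sidePairs_le hT hN hmin A) zero_le_two
    _ = 2 * Real.exp (-(N / 60)) * ∑ S ∈ sides V, Real.exp (-T * #(bdry a b S)) := by
        rw [subsetExp_const_mul, subsetExp_sum, mul_assoc]
        congr 2
        refine sum_congr rfl fun S _ => ?_
        rw [subsetExp_disjoint q univ (bdry a b S) (fun _ => Real.exp (-(T / 10) * #(bdry a b S))),
          subsetExp_const, univ_inter, hsplit]

end graph


section transfer

/-! ### Cuts of a `Graph` -/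

variable {α β : Type*} (G : Graph α β)

/-- A chosen first end of an edge. -/
def fstEnd (e : G.edgeSet) : G.vertexSet :=
  ⟨_, (G.exists_isLink_of_mem_edgeSet e.2).choose_spec.choose_spec.left_mem⟩

/-- The second end of an edge. -/
def sndEnd (e : G.edgeSet) : G.vertexSet :=
  ⟨_, (G.exists_isLink_of_mem_edgeSet e.2).choose_spec.choose_spec.right_mem⟩

lemma isLink_ends (e : G.edgeSet) : G.IsLink e (fstEnd G e) (sndEnd G e) :=
  (G.exists_isLink_of_mem_edgeSet e.2).choose_spec.choose_spec

variable [Fintype G.vertexSet] [Fintype G.edgeSet]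

/-- The boundary of a set of vertices, as a set of edges of `G`. -/
def cutOf (S : Finset G.vertexSet) : Set β :=
  (↑) '' (bdry (fstEnd G) (sndEnd G) S : Set G.edgeSet)

variable {G}

lemma boundary_image (S : Finset G.vertexSet) :
    boundary G ((↑) '' (S : Set G.vertexSet)) = cutOf G S := by
  have hmem : ∀ v : G.vertexSet, (v : α) ∈ ((↑) '' (S : Set G.vertexSet) : Set α) ↔ v ∈ S := by
    intro v
    simp
  ext e
  simp only [boundary, Set.mem_ofPred_eq, cutOf, Set.mem_image, mem_coe]
  constructor
  · rintro ⟨x, y, hxy, hx, hy⟩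
    refine ⟨⟨e, hxy.edge_mem⟩, ?_, rfl⟩
    rw [mem_bdry, ← hmem, ← hmem]
    have hl := isLink_ends G ⟨e, hxy.edge_mem⟩
    rcases hxy.eq_and_eq_or_eq_and_eq hl with ⟨h1, h2⟩ | ⟨h1, h2⟩
    · rw [← h1, ← h2]
      exact fun h => hy (h.1 hx)
    · rw [← h1, ← h2]
      exact fun h => hy (h.2 hx)
  · rintro ⟨e, he, rfl⟩
    rw [mem_bdry, ← hmem, ← hmem] at he
    have hl := isLink_ends G e
    by_cases h : ((fstEnd G e : G.vertexSet) : α) ∈ ((↑) '' (S : Set G.vertexSet) : Set α)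
    · exact ⟨_, _, hl, h, fun h' => he ⟨fun _ => h', fun _ => h⟩⟩
    · exact ⟨_, _, hl.symm, by_contra fun h' => he ⟨fun h'' => (h h'').elim, fun h'' => (h' h'').elim⟩, h⟩

lemma isCut_iff {C : Set β} : IsCut G C ↔ ∃ S ∈ sides G.vertexSet, cutOf G S = C := by
  constructor
  · rintro ⟨S, hne, hss, rfl⟩
    have hS : ((↑) '' (({v | (v : α) ∈ S} : Finset G.vertexSet) : Set G.vertexSet)) = S := by
      ext x
      simp only [coe_filter, mem_univ, true_and, Set.mem_image, Set.mem_ofPred_eq]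
      exact ⟨fun ⟨v, hv, h⟩ => h ▸ hv, fun hx => ⟨⟨x, hss.1 hx⟩, hx, rfl⟩⟩
    refine ⟨({v | (v : α) ∈ S} : Finset G.vertexSet), ?_, ?_⟩
    · rw [mem_sides]
      constructor
      · obtain ⟨x, hx⟩ := hne
        exact ⟨⟨x, hss.1 hx⟩, by simpa using hx⟩
      · intro h
        refine hss.2 fun x hx => ?_
        have : (⟨x, hx⟩ : G.vertexSet) ∈ ({v | (v : α) ∈ S} : Finset G.vertexSet) := by
          rw [h]; exact mem_univ _
        simpa using this
    · rw [← boundary_image, hS]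
  · rintro ⟨S, hS, rfl⟩
    rw [mem_sides] at hS
    refine ⟨(↑) '' (S : Set G.vertexSet), ?_, ?_, (boundary_image S).symm⟩
    · obtain ⟨v, hv⟩ := hS.1
      exact ⟨v, v, hv, rfl⟩
    · refine ⟨?_, fun h => hS.2 ?_⟩
      · rintro _ ⟨v, -, rfl⟩
        exact v.2
      · rw [eq_univ_iff_forall]
        intro v
        obtain ⟨w, hw, hwv⟩ := h v.2
        rwa [← Subtype.ext hwv]

lemma ncard_cutOf (S : Finset G.vertexSet) :
    (cutOf G S).ncard = #(bdry (fstEnd G) (sndEnd G) S) := by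
  rw [cutOf, Set.ncard_image_of_injective _ Subtype.val_injective, Set.ncard_coe_finset]

lemma ncard_cutOf_union (S S' : Finset G.vertexSet) :
    (cutOf G S ∪ cutOf G S').ncard =
      #(bdry (fstEnd G) (sndEnd G) S ∪ bdry (fstEnd G) (sndEnd G) S') := by
  rw [cutOf, cutOf, ← Set.image_union, ← coe_union,
    Set.ncard_image_of_injective _ Subtype.val_injective, Set.ncard_coe_finset]

lemma cutOf_eq_iff {S S' : Finset G.vertexSet} :
    cutOf G S = cutOf G S' ↔
      bdry (fstEnd G) (sndEnd G) S = bdry (fstEnd G) (sndEnd G) S' := by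
  rw [cutOf, cutOf, (Set.image_injective.2 Subtype.val_injective).eq_iff, coe_inj]

lemma expFailedCuts_eq (p : ℝ) :
    expFailedCuts G p = ∑ C ∈ (sides G.vertexSet).image (cutOf G), p ^ C.ncard := by
  rw [expFailedCuts, ← finsum_mem_coe_finset]
  refine finsum_mem_congr (Set.ext fun C => ?_) fun _ _ => rfl
  simp [isCut_iff, and_assoc]

lemma expFailedCutPairs_le {p : ℝ} (hp : 0 ≤ p) :
    expFailedCutPairs G p ≤ ∑ P ∈ sidePairs (fstEnd G) (sndEnd G),
      p ^ #(bdry (fstEnd G) (sndEnd G) P.1 ∪ bdry (fstEnd G) (sndEnd G) P.2) := by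
  set f : Finset G.vertexSet × Finset G.vertexSet → Set β × Set β :=
    fun P => (cutOf G P.1, cutOf G P.2) with hf
  have h1 : expFailedCutPairs G p =
      ∑ Q ∈ (sidePairs (fstEnd G) (sndEnd G)).image f, p ^ (Q.1 ∪ Q.2).ncard := by
    rw [expFailedCutPairs, ← finsum_mem_coe_finset]
    refine finsum_mem_congr (Set.ext fun Q => ?_) fun _ _ => rfl
    simp only [isCut_iff, Set.mem_ofPred_eq, coe_image, Set.mem_image, mem_coe, sidePairs,
      mem_filter, mem_product, hf]
    constructor
    · rintro ⟨⟨S, hS, h1⟩, ⟨S', hS', h2⟩, hne⟩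
      refine ⟨(S, S'), ⟨⟨hS, hS'⟩, fun h => hne ?_⟩, Prod.ext h1 h2⟩
      rw [← h1, ← h2, cutOf_eq_iff]
      exact h
    · rintro ⟨P, ⟨⟨hS, hS'⟩, hne⟩, rfl⟩
      exact ⟨⟨_, hS, rfl⟩, ⟨_, hS', rfl⟩, fun h => hne (cutOf_eq_iff.1 h)⟩
  have h2 : ∑ P ∈ sidePairs (fstEnd G) (sndEnd G),
      p ^ #(bdry (fstEnd G) (sndEnd G) P.1 ∪ bdry (fstEnd G) (sndEnd G) P.2) =
      ∑ P ∈ sidePairs (fstEnd G) (sndEnd G), p ^ ((f P).1 ∪ (f P).2).ncard :=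
    sum_congr rfl fun P _ => by rw [ncard_cutOf_union]
  rw [h1, h2, sum_comp (fun Q : Set β × Set β => p ^ (Q.1 ∪ Q.2).ncard) f]
  refine sum_le_sum fun Q hQ => ?_
  obtain ⟨P, hP, hPQ⟩ := mem_image.1 hQ
  have : 1 ≤ #{P ∈ sidePairs (fstEnd G) (sndEnd G) | f P = Q} :=
    card_pos.2 ⟨P, mem_filter.2 ⟨hP, hPQ⟩⟩
  rw [nsmul_eq_mul]
  exact le_mul_of_one_le_left (by positivity) (by exact_mod_cast this)

/-- When no boundary is empty, that is when `G` is connected, a cut is the boundary of exactly two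
vertex sets. -/
lemma sum_sides_le {p : ℝ} (hp : 0 ≤ p)
    (hconn : ∀ S ∈ sides G.vertexSet, bdry (fstEnd G) (sndEnd G) S ≠ ∅) :
    ∑ S ∈ sides G.vertexSet, p ^ #(bdry (fstEnd G) (sndEnd G) S) ≤ 2 * expFailedCuts G p := by
  have h1 : ∑ S ∈ sides G.vertexSet, p ^ #(bdry (fstEnd G) (sndEnd G) S) =
      ∑ S ∈ sides G.vertexSet, p ^ (cutOf G S).ncard :=
    sum_congr rfl fun S _ => by rw [ncard_cutOf]
  rw [h1, expFailedCuts_eq, mul_sum, sum_comp (fun C : Set β => p ^ C.ncard) (cutOf G)]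
  refine sum_le_sum fun C hC => ?_
  obtain ⟨S, hS, rfl⟩ := mem_image.1 hC
  rw [nsmul_eq_mul]
  refine mul_le_mul_of_nonneg_right ?_ (by positivity)
  have : #{S' ∈ sides G.vertexSet | cutOf G S' = cutOf G S} ≤
      #({S, Sᶜ} : Finset (Finset G.vertexSet)) := by
    refine card_le_card fun S' hS' => ?_
    rw [mem_filter, cutOf_eq_iff] at hS'
    rw [mem_insert, mem_singleton]
    refine (eq_or_forall_mem_iff_notMem hconn hS'.2).imp_right fun h => ?_
    ext v
    rw [mem_compl, h v]
  have h2 := this.trans card_le_two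
  exact_mod_cast h2

lemma pow_card_bdry_le {p : ℝ} (hp : 0 ≤ p) {S : Finset G.vertexSet}
    (hS : S ∈ sides G.vertexSet) :
    p ^ #(bdry (fstEnd G) (sndEnd G) S) ≤ expFailedCuts G p := by
  rw [expFailedCuts_eq, ← ncard_cutOf]
  exact single_le_sum (f := fun C : Set β => p ^ C.ncard) (fun C _ => by positivity)
    (mem_image_of_mem _ hS)

end transfer

end

end Unreliability

theorem mainTheorem11 :
    ∃ c : ℝ, 0 < c ∧ ∃ n₀ : ℕ, ∀ {α β : Type*} (G : Graph α β),
      G.vertexSet.Finite → G.edgeSet.Finite → n₀ ≤ G.vertexSet.ncard →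
      ∀ p : ℝ, 0 < p → p < 1 →
        Unreliability.expFailedCuts G p ≤ 1 / (G.vertexSet.ncard : ℝ) →
        Unreliability.expFailedCutPairs G p ≤
          (G.vertexSet.ncard : ℝ) ^ (-c) * Unreliability.expFailedCuts G p := by
  refine ⟨1 / 100, by norm_num, ⌈Real.exp 10000⌉₊, ?_⟩
  intro α β G hVfin hEfin hn p hp0 hp1 hz
  have : Fintype G.vertexSet := hVfin.fintype
  have : Fintype G.edgeSet := hEfin.fintype
  set n := G.vertexSet.ncard with hn'
  have hnexp : Real.exp 10000 ≤ n := Nat.ceil_le.1 hn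
  have hn0 : (0 : ℝ) < n := (Real.exp_pos _).trans_le hnexp
  set N := Real.log n with hN
  have hexpN : Real.exp N = n := Real.exp_log hn0
  have hN1 : 10000 ≤ N := (Real.le_log_iff_exp_le hn0).2 hnexp
  set T := -Real.log p with hT
  have hT0 : 0 < T := neg_pos.2 (Real.log_neg hp0 hp1)
  have hpow : ∀ k : ℕ, p ^ k = Real.exp (-T * k) := by
    intro k
    rw [hT, neg_neg, mul_comm, Real.exp_nat_mul, Real.exp_log hp0]
  have hinv : 1 / (n : ℝ) = Real.exp (-N) := by rw [Real.exp_neg, hexpN, one_div]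
  rw [hinv] at hz
  open Unreliability in
  have hmin : ∀ S ∈ sides G.vertexSet,
      N ≤ T * (bdry (fstEnd G) (sndEnd G) S).card := by
    intro S hS
    have h1 := (pow_card_bdry_le hp0.le hS).trans hz
    rw [hpow, Real.exp_le_exp] at h1
    linarith
  open Unreliability in
  have hsum := sum_sides_le (G := G) hp0.le (fun S hS h0 => by
    have h1 := hmin S hS
    rw [h0, Finset.card_empty, Nat.cast_zero, mul_zero] at h1
    linarith)
  have hpairs := Unreliability.expFailedCutPairs_le (G := G) hp0.le
  simp only [hpow] at hsum hpairs
  have hcard : (Fintype.card G.vertexSet : ℝ) = Real.exp N := by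
    rw [hexpN, hn', ← Nat.card_coe_set_eq, Nat.card_eq_fintype_card]
  have hmain := Unreliability.sum_exp_sidePairs_le hT0 hN1 hcard hmin (hsum.trans (by linarith))
  have hz0 : 0 ≤ Unreliability.expFailedCuts G p := by
    rw [Unreliability.expFailedCuts_eq]
    exact Finset.sum_nonneg fun C _ => by positivity
  have hrpow : (n : ℝ) ^ (-(1 / 100) : ℝ) = Real.exp (-(N / 100)) := by
    rw [Real.rpow_def_of_pos hn0]; congr 1; ring
  have hconst : 4 * Real.exp (-(N / 60)) ≤ Real.exp (-(N / 100)) := by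
    have h1 : 4 ≤ Real.exp (N / 150) := by
      have := Real.add_one_le_exp (N / 150)
      linarith
    calc 4 * Real.exp (-(N / 60)) ≤ Real.exp (N / 150) * Real.exp (-(N / 60)) := by gcongr
      _ = Real.exp (-(N / 100)) := by rw [← Real.exp_add]; congr 1; ring
  rw [hrpow]
  calc Unreliability.expFailedCutPairs G p ≤ _ :=
        (hpairs.trans_eq (Finset.sum_congr rfl fun P _ => by congr!)).trans hmain
    _ ≤ 2 * Real.exp (-(N / 60)) * (2 * Unreliability.expFailedCuts G p) := by gcongr
    _ = 4 * Real.exp (-(N / 60)) * Unreliability.expFailedCuts G p := by ring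
    _ ≤ _ := by gcongr
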